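/- Let $k$ be an even integer with $k=10$ or $k>14$. Let $p$ be the smallest prime greater than $k$, except that for $k=32$ we take $p=43$. Put $d=\gcd(p-1,k-2)$ and $m=(p-1)/d$, and put $$t=\begin{cases}(m+1)/2 & \text{if } m \text{ is odd},\\ m/2+2 & \text{if } m \text{ is even and } 4\nmid m,\\ m/2+1 & \text{if } 4\mid m.\end{cases}$$ (a) We have $m>6$ if $k\neq 10$ and $m=5$ if $k=10$; in particular $\varphi(m)>2$. Moreover $t<m$, $\gcd(t,m)=1$, and both integers $k'=dt+2$ and $k'=p+1-dt$ are smaller than $k$. (b) For $k\le 36$ the values are as follows, where the last column lists $dt+2$ and $p+1-dt$: $$\begin{array}{c|c|c|c|c|c}k&p&d&m&t&k'\\\hline 10&11&2&5&3&8,\ 6\\16&17&2&8&5&12,\ 8\\18&19&2&9&5&12,\ 10\\20&23&2&11&6&14,\ 12\\22&23&2&11&6&14,\ 12\\24&29&2&14&9&20,\ 12\\26&29&4&7&4&18,\ 14\\28&29&2&14&9&20,\ 12\\30&31&2&15&8&18,\ 16\\32&43&6&7&4&26,\ 20\\34&37&4&9&5&22,\ 18\\36&37&2&18&11&24,\ 16\end{array}$$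 (c) If $k>36$ and $q$ is the largest prime less than $k$, then $(p-1)/(k-2)<1.15$, and for both values of $k'$ we have $p/k'>1.144$ and $k'<q$. (d) Let $p_n<p_{n+1}$ be consecutive primes with $p_{n+1}>37$. Then $p_{n+1}/p_n<1.144$ and $(p_{n+1}-1)/(p_n-1)<1.15$. (e) For all integers $d\ge 1$ and $m>6$, with $t$ given in terms of $m$ by the rule above, $$\frac{dm+1}{dt+2}>1.144\qquad\text{and}\qquad\frac{dm+1}{(dm+1)+1-dt}>1.144 .$$ -/

import Mathlib

namespace WeightReduction

/-- `p` is the prime attached to the weight `k`: the smallest prime greater than `k`,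
except that for `k = 32` one takes `p = 43`. -/
def IsWeightPrime (k p : ℕ) : Prop :=
  if k = 32 then p = 43 else IsLeast {q : ℕ | q.Prime ∧ k < q} p

/-- `d = gcd (p - 1, k - 2)`. -/
def gcdIndex (k p : ℕ) : ℕ := Nat.gcd (p - 1) (k - 2)

/-- `m = (p - 1) / d`. -/
def charOrder (k p : ℕ) : ℕ := (p - 1) / gcdIndex k p

/-- The exponent `t` as a function of `m`. -/
def expo (m : ℕ) : ℕ :=
  if m % 2 = 1 then (m + 1) / 2
  else if m % 4 = 0 then m / 2 + 1
  else m / 2 + 2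

/-- The first of the two new weights, `d t + 2`. -/
def newWeight₁ (k p : ℕ) : ℤ :=
  (gcdIndex k p : ℤ) * (expo (charOrder k p) : ℤ) + 2

/-- The second of the two new weights, `p + 1 - d t`. -/
def newWeight₂ (k p : ℕ) : ℤ :=
  (p : ℤ) + 1 - (gcdIndex k p : ℤ) * (expo (charOrder k p) : ℤ)

/-- A row of the table: for the weight `k` the prime is `p`, the invariants are `d`, `m`, `t`,
and the two new weights are `a = d t + 2` and `b = p + 1 - d t`. -/
def TableRow (k p d m t : ℕ) (a b : ℤ) : Prop :=
  IsWeightPrime k p ∧ gcdIndex k p = d ∧ charOrder k p = m ∧ expo m = t ∧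
    newWeight₁ k p = a ∧ newWeight₂ k p = b

end WeightReduction

/-! Everything beyond the finite table rests on one fact, `exists_prime_gt_and_lt`: for `a ≥ 37`
some prime `p` satisfies `a < p < 1.144 a`.

For `a ≥ 10 ^ 8` this is Chebyshev's method. If `∑ c / d = 0`, then `∑ c log ⌊N/d⌋!` equals `-N ∑ c
log d / d` up to `O(log N)`, and it also equals `∑ Λ(m) F(⌊N/m⌋)` with `F` periodic. Comparing `F`
with a step function, a finite check, bounds combinations of `ψ(N/d)`. Feeding rough bounds back in
gives `ψ(N) ≤ 1.0632 N` and `ψ(N) ≥ 0.9378 N` up to constants, and `1.144 * (0.9378 - 0.0037) >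
1.0632`, where `0.0037` pays for `ψ - θ`. Below `10 ^ 8` an explicit chain of primes suffices.

For the weights, `t` is about `m/2`, so both `k'` are about `p/2`, and `m > 6` already forces `p >
1.144 k'`. If `m ≤ 6`, then `(k-2)/d < m` would give `(p-1)/(k-2) ≥ 6/5`, too large a gap once `k >
36`. Finally `p < 1.144 q` turns `p > 1.144 k'` into `k' < q`. -/

namespace WeightReduction

open Chebyshev ArithmeticFunction Finset

/-! ### Chebyshev's identity for weighted sums of `log ⌊N/d⌋!` -/

/-- The weighted sum `∑ c * f d` over the pairs `(d, c)` in `l`. -/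
noncomputable def weightedSum (l : List (ℕ × ℤ)) (f : ℕ → ℝ) : ℝ :=
  (l.map fun p => (p.2 : ℝ) * f p.1).sum

@[simp] theorem weightedSum_nil (f : ℕ → ℝ) : weightedSum [] f = 0 := rfl

@[simp] theorem weightedSum_cons (p : ℕ × ℤ) (l : List (ℕ × ℤ)) (f : ℕ → ℝ) :
    weightedSum (p :: l) f = p.2 * f p.1 + weightedSum l f := by
  simp [weightedSum]

/-- The function `M ↦ ∑ c * ⌊M / d⌋` over the pairs `(d, c)` in `l`. -/
def floorComb (l : List (ℕ × ℤ)) (M : ℕ) : ℤ :=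
  (l.map fun p => p.2 * ((M / p.1 : ℕ) : ℤ)).sum

theorem floorComb_cons (p : ℕ × ℤ) (l : List (ℕ × ℤ)) (M : ℕ) :
    floorComb (p :: l) M = p.2 * ((M / p.1 : ℕ) : ℤ) + floorComb l M := by
  simp [floorComb]

/-- The step function `M ↦ ∑ c * [d ≤ M]` over the pairs `(d, c)` in `w`. -/
def stepComb (w : List (ℕ × ℤ)) (M : ℕ) : ℤ :=
  (w.map fun p => if p.1 ≤ M then p.2 else 0).sum

theorem stepComb_cons (p : ℕ × ℤ) (w : List (ℕ × ℤ)) (M : ℕ) :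
    stepComb (p :: w) M = (if p.1 ≤ M then p.2 else 0) + stepComb w M := by
  simp [stepComb]

/-- Sum the convolution identity `Λ * ζ = log` up to `N`. -/
theorem sum_vonMangoldt_mul_div (N : ℕ) :
    ∑ m ∈ Ioc 0 N, Λ m * ((N / m : ℕ) : ℝ) = Real.log (N.factorial : ℝ) := by
  rw [← sum_Ioc_mul_zeta_eq_sum, vonMangoldt_mul_zeta]
  induction N with
  | zero => simp
  | succ n ih =>
    rw [sum_Ioc_succ_top (Nat.zero_le n), ih, Nat.factorial_succ, Nat.cast_mul,
      Real.log_mul (by positivity) (by positivity), log_apply, add_comm]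

theorem sum_vonMangoldt_mul_div_div (N d : ℕ) :
    ∑ m ∈ Ioc 0 N, Λ m * ((N / m / d : ℕ) : ℝ) = Real.log ((N / d).factorial : ℝ) := by
  rw [← sum_vonMangoldt_mul_div]
  refine (sum_subset_zero_on_sdiff (Ioc_subset_Ioc_right (Nat.div_le_self N d)) ?_ ?_).symm
  · intro m hm
    simp only [mem_sdiff, mem_Ioc, not_and, not_le] at hm
    have : N / d / m = 0 := Nat.div_eq_of_lt (hm.2 hm.1.1)
    rw [Nat.div_div_eq_div_mul, mul_comm m d, ← Nat.div_div_eq_div_mul, this]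
    simp
  · intro m _
    rw [Nat.div_div_eq_div_mul, Nat.div_div_eq_div_mul, mul_comm d m]

/-- For positive `m` and `d`, `d ≤ ⌊N/m⌋` holds exactly when `m ≤ ⌊N/d⌋`. -/
theorem sum_vonMangoldt_mul_step (N d : ℕ) (hd : 0 < d) :
    ∑ m ∈ Ioc 0 N, Λ m * (if d ≤ N / m then 1 else 0) = psi ((N / d : ℕ) : ℝ) := by
  rw [psi, Nat.floor_natCast]
  refine (sum_subset_zero_on_sdiff (Ioc_subset_Ioc_right (Nat.div_le_self N d)) ?_ ?_).symm
  · intro m hm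
    simp only [mem_sdiff, mem_Ioc, not_and, not_le] at hm
    have h := hm.2 hm.1.1
    rw [if_neg, mul_zero]
    rw [Nat.le_div_iff_mul_le hm.1.1]
    rw [Nat.div_lt_iff_lt_mul hd] at h
    rw [mul_comm]; omega
  · intro m hm
    simp only [mem_Ioc] at hm
    rw [if_pos, mul_one]
    rw [Nat.le_div_iff_mul_le hm.1]
    have := (Nat.le_div_iff_mul_le hd).1 hm.2
    rwa [mul_comm]

theorem weightedSum_log_factorial (l : List (ℕ × ℤ)) (N : ℕ) :
    weightedSum l (fun d => Real.log ((N / d).factorial : ℝ)) =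
      ∑ m ∈ Ioc 0 N, Λ m * (floorComb l (N / m) : ℝ) := by
  induction l with
  | nil => simp [floorComb]
  | cons p l ih =>
    rw [weightedSum_cons, ih, ← sum_vonMangoldt_mul_div_div, mul_sum, ← sum_add_distrib]
    refine sum_congr rfl fun m _ => ?_
    rw [floorComb_cons, Int.cast_add, Int.cast_mul, Int.cast_natCast]
    ring

theorem weightedSum_psi (w : List (ℕ × ℤ)) (hw : ∀ p ∈ w, 0 < p.1) (N : ℕ) :
    weightedSum w (fun d => psi ((N / d : ℕ) : ℝ)) =
      ∑ m ∈ Ioc 0 N, Λ m * (stepComb w (N / m) : ℝ) := by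
  induction w with
  | nil => simp [stepComb]
  | cons p w ih =>
    rw [weightedSum_cons, ih fun q hq => hw q (List.mem_cons_of_mem _ hq),
      ← sum_vonMangoldt_mul_step N p.1 (hw p List.mem_cons_self), mul_sum, ← sum_add_distrib]
    refine sum_congr rfl fun m _ => ?_
    rw [stepComb_cons]
    split_ifs <;> push_cast <;> ring

/-- A pointwise inequality between step functions gives an inequality for `log` of factorials
and the Chebyshev function. -/
theorem weightedSum_log_factorial_add_psi_nonneg (l w : List (ℕ × ℤ)) (hw : ∀ p ∈ w, 0 < p.1)
    (h : ∀ M, 0 ≤ floorComb l M + stepComb w M) (N : ℕ) :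
    0 ≤ weightedSum l (fun d => Real.log ((N / d).factorial : ℝ)) +
      weightedSum w (fun d => psi ((N / d : ℕ) : ℝ)) := by
  rw [weightedSum_log_factorial, weightedSum_psi w hw, ← sum_add_distrib]
  refine sum_nonneg fun m _ => ?_
  rw [← mul_add]
  exact mul_nonneg vonMangoldt_nonneg (by exact_mod_cast h (N / m))

theorem floorComb_add_period (l : List (ℕ × ℤ)) (P : ℕ) (hl : ∀ p ∈ l, 0 < p.1 ∧ p.1 ∣ P) (M : ℕ) :
    floorComb l (M + P) = floorComb l M + floorComb l P := by
  induction l with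
  | nil => simp [floorComb]
  | cons p l ih =>
    have h := ih fun q hq => hl q (List.mem_cons_of_mem _ hq)
    obtain ⟨h0, hd⟩ := hl p List.mem_cons_self
    simp only [floorComb_cons]
    rw [h, Nat.add_div_of_dvd_left hd]
    push_cast
    ring

theorem stepComb_of_le (w : List (ℕ × ℤ)) (K M : ℕ) (hw : ∀ p ∈ w, p.1 ≤ K) (hM : K ≤ M) :
    stepComb w M = stepComb w K := by
  unfold stepComb
  congr 1
  refine List.map_congr_left fun p hp => ?_
  have := hw p hp
  rw [if_pos (by omega), if_pos this]

/-- Periodicity reduces the pointwise inequality to finitely many cases. -/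
theorem floorComb_add_stepComb_nonneg (l w : List (ℕ × ℤ)) (P : ℕ) (hP : 0 < P)
    (hl : ∀ p ∈ l, 0 < p.1 ∧ p.1 ∣ P) (h0 : floorComb l P = 0) (hw : ∀ p ∈ w, p.1 ≤ P)
    (h : ∀ M < 2 * P, 0 ≤ floorComb l M + stepComb w M) (M : ℕ) :
    0 ≤ floorComb l M + stepComb w M := by
  induction M using Nat.strong_induction_on with
  | _ M ih =>
    by_cases hM : M < 2 * P
    · exact h M hM
    · obtain ⟨K, rfl⟩ := Nat.exists_eq_add_of_le' (show P ≤ M by omega)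
      have hK := ih K (by omega)
      rw [floorComb_add_period l P hl, h0, add_zero]
      rwa [stepComb_of_le w P (K + P) hw (by omega), ← stepComb_of_le w P K hw (by omega)]

/-! ### Stirling estimates and the resulting inequality for `ψ` -/

theorem log_factorial_le {n : ℕ} (hn : 1 ≤ n) :
    Real.log (n.factorial : ℝ) ≤ n * Real.log n - n + 1 + Real.log n := by
  induction n, hn using Nat.le_induction with
  | base => simp
  | succ n hn ih =>
    have hn' : (0 : ℝ) < n := by exact_mod_cast hn
    rw [Nat.factorial_succ, Nat.cast_mul, Real.log_mul (by positivity) (by positivity)]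
    have h := Real.log_le_sub_one_of_pos (x := (n : ℝ) / (n + 1)) (by positivity)
    rw [Real.log_div (by positivity) (by positivity)] at h
    have h2 : (n : ℝ) / (n + 1) - 1 = -1 / (n + 1) := by field_simp; ring
    rw [h2, le_div_iff₀ (by positivity)] at h
    push_cast
    nlinarith

theorem abs_log_factorial_floor_sub_le {y : ℝ} (hy : 1 ≤ y) :
    |Real.log (⌊y⌋₊.factorial : ℝ) - (y * Real.log y - y)| ≤ Real.log y + 1 := by
  have hn : 1 ≤ ⌊y⌋₊ := (Nat.one_le_floor_iff _).2 hy
  have hny : (⌊y⌋₊ : ℝ) ≤ y := Nat.floor_le (by linarith)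
  have hyn : y < ⌊y⌋₊ + 1 := Nat.lt_floor_add_one y
  have hup := log_factorial_le hn
  have hlo := Stirling.le_log_factorial_stirling (n := ⌊y⌋₊) (by omega)
  generalize hnn : ⌊y⌋₊ = n at *
  have hn' : (1 : ℝ) ≤ n := by exact_mod_cast hn
  have hl0 : 0 ≤ Real.log n := Real.log_nonneg hn'
  have hlle : Real.log n ≤ Real.log y := Real.log_le_log (by linarith) hny
  have hpi : 0 ≤ Real.log (2 * Real.pi) :=
    Real.log_nonneg (by nlinarith [Real.pi_gt_three])
  -- The tangent bounds for `y / n` and `n / y` compare `n log n - n` with `y log y - y` from both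
  -- sides.
  have h1 := Real.log_le_sub_one_of_pos (x := y / n) (by positivity)
  rw [Real.log_div (by positivity) (by positivity), le_sub_iff_add_le, le_div_iff₀ (by linarith)]
    at h1
  have h2 := Real.log_le_sub_one_of_pos (x := n / y) (by positivity)
  rw [Real.log_div (by positivity) (by positivity), le_sub_iff_add_le, le_div_iff₀ (by linarith)]
    at h2
  rw [abs_le]
  constructor
  · nlinarith
  · nlinarith

theorem abs_weightedSum_log_factorial_le (l : List (ℕ × ℤ)) (N : ℕ)
    (hl : ∀ p ∈ l, 0 < p.1 ∧ p.1 ≤ N) :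
    |weightedSum l (fun d => Real.log ((N / d).factorial : ℝ)) -
        (weightedSum l (fun d => 1 / (d : ℝ)) * (N * Real.log N - N) -
          N * weightedSum l (fun d => Real.log d / d))| ≤
      (l.map fun p => |(p.2 : ℝ)|).sum * (Real.log N + 1) := by
  induction l with
  | nil => simp
  | cons p l ih =>
    have h := ih fun q hq => hl q (List.mem_cons_of_mem _ hq)
    obtain ⟨h0, hN⟩ := hl p List.mem_cons_self
    have h0' : (1 : ℝ) ≤ p.1 := by exact_mod_cast h0
    have hN' : (p.1 : ℝ) ≤ N := by exact_mod_cast hN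
    have hN0 : (0 : ℝ) < N := by linarith
    have hy : (1 : ℝ) ≤ (N : ℝ) / p.1 := by rwa [one_le_div (by linarith)]
    have h1 := abs_log_factorial_floor_sub_le hy
    rw [Nat.floor_div_eq_div, Real.log_div (by positivity) (by positivity)] at h1
    have h2 : 0 ≤ Real.log p.1 := Real.log_nonneg h0'
    have h3 : |(p.2 : ℝ) * (Real.log ((N / p.1).factorial : ℝ) -
        ((N : ℝ) / p.1 * (Real.log N - Real.log p.1) - (N : ℝ) / p.1))| ≤
        |(p.2 : ℝ)| * (Real.log N + 1) := by
      rw [abs_mul]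
      exact mul_le_mul_of_nonneg_left (h1.trans (by linarith)) (abs_nonneg _)
    simp only [weightedSum_cons, List.map_cons, List.sum_cons]
    rw [add_mul |(p.2 : ℝ)|]
    refine le_trans (le_of_eq ?_) ((abs_add_le _ _).trans (add_le_add h3 h))
    congr 1
    ring

/-- By divisibility, `floorComb l P = 0` says `∑ c / d = 0`. This kills the `N log N` term and
leaves only `-N ∑ c log d / d` plus a logarithmic error. -/
theorem psi_inequality_of_floorComb (l w : List (ℕ × ℤ)) (P : ℕ) (hP : 0 < P)
    (hl : ∀ p ∈ l, 0 < p.1 ∧ p.1 ∣ P) (h0 : floorComb l P = 0)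
    (hw : ∀ p ∈ w, 0 < p.1 ∧ p.1 ≤ P)
    (h : ∀ M < 2 * P, 0 ≤ floorComb l M + stepComb w M) (N : ℕ) (hN : P ≤ N) :
    0 ≤ -(N * weightedSum l (fun d => Real.log d / d)) +
      (l.map fun p => |(p.2 : ℝ)|).sum * (Real.log N + 1) +
      weightedSum w (fun d => psi ((N / d : ℕ) : ℝ)) := by
  have hinv : ∀ l : List (ℕ × ℤ), (∀ p ∈ l, 0 < p.1 ∧ p.1 ∣ P) →
      (P : ℝ) * weightedSum l (fun d => 1 / (d : ℝ)) = (floorComb l P : ℝ) := by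
    intro l hl
    induction l with
    | nil => simp [floorComb]
    | cons p l ih =>
      obtain ⟨hp, hd⟩ := hl p List.mem_cons_self
      rw [weightedSum_cons, mul_add, ih fun q hq => hl q (List.mem_cons_of_mem _ hq),
        floorComb_cons, Int.cast_add, Int.cast_mul, Int.cast_natCast,
        Nat.cast_div hd (by positivity)]
      ring
  have hz : weightedSum l (fun d => 1 / (d : ℝ)) = 0 := by
    have := hinv l hl
    rw [h0, Int.cast_zero] at this
    exact (mul_eq_zero.1 this).resolve_left (by positivity)
  have h1 := weightedSum_log_factorial_add_psi_nonneg l w (fun p hp => (hw p hp).1)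
    (floorComb_add_stepComb_nonneg l w P hP hl h0 (fun p hp => (hw p hp).2) h) N
  have h2 := abs_weightedSum_log_factorial_le l N
    fun p hp => ⟨(hl p hp).1, (Nat.le_of_dvd hP (hl p hp).2).trans hN⟩
  rw [hz, zero_mul, zero_sub, abs_le] at h2
  linarith [h2.2]

/-! ### Numerical logarithms and the main constants -/

theorem log_smooth (a b c d : ℕ) :
    Real.log (2 ^ a * 3 ^ b * 5 ^ c * 7 ^ d) =
      a * Real.log 2 + b * Real.log 3 + c * Real.log 5 + d * Real.log 7 := by
  rw [Real.log_mul (by positivity) (by positivity), Real.log_mul (by positivity) (by positivity),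
    Real.log_mul (by positivity) (by positivity)]
  simp only [Real.log_pow]

theorem log_seven_mem : 1.945909 < Real.log 7 ∧ Real.log 7 < 1.945911 := by
  -- `2401 = 7 ^ 4` and `2400 = 2 ^ 5 * 3 * 5 ^ 2` are consecutive, so `log 7` follows from the
  -- logarithms of 2, 3, 5.
  have h1 : Real.log 2401 = 4 * Real.log 7 := by
    have := log_smooth 0 0 0 4; norm_num at this; linarith
  have h2 : Real.log 2400 = 5 * Real.log 2 + Real.log 3 + 2 * Real.log 5 := by
    have := log_smooth 5 1 2 0; norm_num at this; linarith
  have h3 := Real.log_le_sub_one_of_pos (x := 2401 / 2400) (by norm_num)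
  have h4 := Real.log_le_sub_one_of_pos (x := 2400 / 2401) (by norm_num)
  rw [Real.log_div (by norm_num) (by norm_num)] at h3 h4
  constructor <;> norm_num at * <;>
  linarith [Real.log_two_gt_d9, Real.log_two_lt_d9, Real.log_three_gt_d9, Real.log_three_lt_d9,
    Real.log_five_gt_d9, Real.log_five_lt_d9]

theorem log_ten_lt : Real.log 10 < 2.3026 := by
  have := log_smooth 1 0 1 0
  norm_num at this
  linarith [Real.log_two_lt_d9, Real.log_five_lt_d9]

/-- The tangent line of `log` at `10 ^ k`; it absorbs logarithmic errors into a tiny slope and a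
constant. -/
theorem log_le_div_ten_pow_add {x : ℝ} (hx : 0 < x) (k : ℕ) :
    Real.log x ≤ x / 10 ^ k + k * 2.3026 - 1 := by
  have h := Real.log_le_sub_one_of_pos (x := x / 10 ^ k) (by positivity)
  rw [Real.log_div (by positivity) (by positivity), Real.log_pow] at h
  have : (k : ℝ) * Real.log 10 ≤ k * 2.3026 :=
    mul_le_mul_of_nonneg_left log_ten_lt.le (Nat.cast_nonneg k)
  linarith

/-- Weights for a lower bound of `ψ` of period `30`. -/
def lowerWeights : List (ℕ × ℤ) := [(1, -1), (2, 1), (3, 1), (5, 1), (30, -1)]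

/-- Weights for a first upper bound of `ψ` of period `420`. -/
def upperWeights : List (ℕ × ℤ) :=
  [(1, 1), (2, -1), (3, -1), (5, -1), (6, 1), (7, -1), (10, 1), (12, -1), (14, 1), (20, -1),
    (28, -1), (30, -1), (35, 1), (42, -1), (60, 2), (70, -1), (84, 2), (105, -1), (140, 1),
    (210, 1), (420, -4)]

/-- Weights for a sharper upper bound of `ψ` of period `420`. -/
def upperWeights' : List (ℕ × ℤ) :=
  [(1, 1), (2, -1), (3, -1), (5, -1), (6, 1), (7, -1), (10, 1), (12, -1), (42, -1), (84, 1),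
    (105, 1), (210, -1)]

/-- Weights for a sharper lower bound of `ψ` of period `420`. -/
def lowerWeights' : List (ℕ × ℤ) :=
  [(1, -1), (2, 1), (3, 1), (5, 1), (6, -1), (7, 1), (14, -1), (21, -1), (28, 1), (42, 2),
    (60, 1), (70, 1), (105, 1), (140, -1), (210, -1), (420, -1)]

theorem log_values :
    Real.log 6 = Real.log 2 + Real.log 3 ∧ Real.log 10 = Real.log 2 + Real.log 5 ∧
    Real.log 12 = 2 * Real.log 2 + Real.log 3 ∧ Real.log 14 = Real.log 2 + Real.log 7 ∧
    Real.log 20 = 2 * Real.log 2 + Real.log 5 ∧ Real.log 21 = Real.log 3 + Real.log 7 ∧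
    Real.log 28 = 2 * Real.log 2 + Real.log 7 ∧
    Real.log 30 = Real.log 2 + Real.log 3 + Real.log 5 ∧
    Real.log 35 = Real.log 5 + Real.log 7 ∧
    Real.log 42 = Real.log 2 + Real.log 3 + Real.log 7 ∧
    Real.log 60 = 2 * Real.log 2 + Real.log 3 + Real.log 5 ∧
    Real.log 70 = Real.log 2 + Real.log 5 + Real.log 7 ∧
    Real.log 84 = 2 * Real.log 2 + Real.log 3 + Real.log 7 ∧
    Real.log 105 = Real.log 3 + Real.log 5 + Real.log 7 ∧
    Real.log 140 = 2 * Real.log 2 + Real.log 5 + Real.log 7 ∧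
    Real.log 210 = Real.log 2 + Real.log 3 + Real.log 5 + Real.log 7 ∧
    Real.log 420 = 2 * Real.log 2 + Real.log 3 + Real.log 5 + Real.log 7 := by
  have h6 := log_smooth 1 1 0 0
  have h10 := log_smooth 1 0 1 0
  have h12 := log_smooth 2 1 0 0
  have h14 := log_smooth 1 0 0 1
  have h20 := log_smooth 2 0 1 0
  have h21 := log_smooth 0 1 0 1
  have h28 := log_smooth 2 0 0 1
  have h30 := log_smooth 1 1 1 0
  have h35 := log_smooth 0 0 1 1
  have h42 := log_smooth 1 1 0 1
  have h60 := log_smooth 2 1 1 0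
  have h70 := log_smooth 1 0 1 1
  have h84 := log_smooth 2 1 0 1
  have h105 := log_smooth 0 1 1 1
  have h140 := log_smooth 2 0 1 1
  have h210 := log_smooth 1 1 1 1
  have h420 := log_smooth 2 1 1 1
  norm_num at *
  refine ⟨?_, ?_, ?_, ?_, ?_, ?_, ?_, ?_, ?_, ?_, ?_, ?_, ?_, ?_, ?_, ?_, ?_⟩ <;> linarith

theorem lt_weightedSum_lowerWeights :
    0.92129 < weightedSum lowerWeights (fun d => Real.log d / d) := by
  obtain ⟨h6, h10, h12, h14, h20, h21, h28, h30, h35, h42, h60, h70, h84, h105, h140, h210,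
    h420⟩ := log_values
  simp [lowerWeights]
  rw [h30]
  linarith [Real.log_two_gt_d9, Real.log_two_lt_d9, Real.log_three_gt_d9, Real.log_three_lt_d9,
    Real.log_five_gt_d9, Real.log_five_lt_d9]

theorem neg_weightedSum_upperWeights_lt :
    -weightedSum upperWeights (fun d => Real.log d / d) < 1.03173 := by
  obtain ⟨h6, h10, h12, h14, h20, h21, h28, h30, h35, h42, h60, h70, h84, h105, h140, h210,
    h420⟩ := log_values
  simp [upperWeights]
  rw [h6, h10, h12, h14, h20, h28, h30, h35, h42, h60, h70, h84, h105, h140, h210, h420]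
  linarith [Real.log_two_gt_d9, Real.log_two_lt_d9, Real.log_three_gt_d9, Real.log_three_lt_d9,
    Real.log_five_gt_d9, Real.log_five_lt_d9, log_seven_mem.1, log_seven_mem.2]

theorem neg_weightedSum_upperWeights'_lt :
    -weightedSum upperWeights' (fun d => Real.log d / d) < 1.00823 := by
  obtain ⟨h6, h10, h12, h14, h20, h21, h28, h30, h35, h42, h60, h70, h84, h105, h140, h210,
    h420⟩ := log_values
  simp [upperWeights']
  rw [h6, h10, h12, h42, h84, h105, h210]
  linarith [Real.log_two_gt_d9, Real.log_two_lt_d9, Real.log_three_gt_d9, Real.log_three_lt_d9,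
    Real.log_five_gt_d9, Real.log_five_lt_d9, log_seven_mem.1, log_seven_mem.2]

theorem lt_weightedSum_lowerWeights' :
    1.07564 < weightedSum lowerWeights' (fun d => Real.log d / d) := by
  obtain ⟨h6, h10, h12, h14, h20, h21, h28, h30, h35, h42, h60, h70, h84, h105, h140, h210,
    h420⟩ := log_values
  simp [lowerWeights']
  rw [h6, h14, h21, h28, h42, h60, h70, h105, h140, h210, h420]
  linarith [Real.log_two_gt_d9, Real.log_two_lt_d9, Real.log_three_gt_d9, Real.log_three_lt_d9,
    Real.log_five_gt_d9, Real.log_five_lt_d9, log_seven_mem.1, log_seven_mem.2]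

/-! ### Bootstrapped linear bounds for `ψ` -/

theorem psi_natCast_le (N : ℕ) : psi (N : ℝ) ≤ 1.5 * N + 10000 := by
  rcases Nat.eq_zero_or_pos N with rfl | hN
  · simp
  have hN' : (1 : ℝ) ≤ N := by exact_mod_cast hN
  have h := psi_le hN'
  have h4 : Real.log 4 = 2 * Real.log 2 := by have := log_smooth 2 0 0 0; norm_num at this; linarith
  set s := √(N : ℝ) with hs
  have hs0 : 0 < s := Real.sqrt_pos.2 (by linarith)
  have hss : s * s = N := Real.mul_self_sqrt (by linarith)
  have hlog : Real.log N = 2 * Real.log s := by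
    rw [← hss, Real.log_mul hs0.ne' hs0.ne']; ring
  have h1 := log_le_div_ten_pow_add hs0 3
  rw [hlog, h4] at h
  norm_num at h1
  have h2 : s * Real.log s ≤ s * (s / 1000 + 6) := mul_le_mul_of_nonneg_left (by linarith) hs0.le
  have h3 : 2 * Real.log 2 * N ≤ 1.3863 * N :=
    mul_le_mul_of_nonneg_right (by linarith [Real.log_two_lt_d9]) (by linarith)
  nlinarith [sq_nonneg (s - 120)]

theorem le_psi_natCast {N : ℕ} (hN : 30 ≤ N) : 0.9212 * N - 100 ≤ psi (N : ℝ) := by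
  have h := psi_inequality_of_floorComb lowerWeights [(1, 1)] 30 (by norm_num)
    (by decide +kernel) (by decide +kernel) (by decide +kernel) (by decide +kernel) N hN
  have hN' : (30 : ℝ) ≤ N := by exact_mod_cast hN
  have hc : (lowerWeights.map fun p => |(p.2 : ℝ)|).sum = 5 := by norm_num [lowerWeights]
  have h1 := mul_le_mul_of_nonneg_left lt_weightedSum_lowerWeights.le (show (0 : ℝ) ≤ N by linarith)
  have h2 := log_le_div_ten_pow_add (show (0 : ℝ) < N by linarith) 6
  rw [hc] at h
  simp only [weightedSum_cons, weightedSum_nil, Nat.div_one] at h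
  norm_num at h h1 h2
  linarith

theorem psi_natCast_le_of_ge {N : ℕ} (hN : 420 ≤ N) : psi (N : ℝ) ≤ 1.0854 * N + 11000 := by
  -- Bounds `ψ(N) - ψ(N/28)`; the crude slope 1.5 at `N/28` costs only `1.5/28`.
  have h := psi_inequality_of_floorComb upperWeights [(28, 1), (1, -1)] 420 (by norm_num)
    (by decide +kernel) (by decide +kernel) (by decide +kernel) (by decide +kernel) N hN
  have hN' : (420 : ℝ) ≤ N := by exact_mod_cast hN
  have hc : (upperWeights.map fun p => |(p.2 : ℝ)|).sum = 26 := by norm_num [upperWeights]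
  have h1 := mul_le_mul_of_nonneg_left neg_weightedSum_upperWeights_lt.le
    (show (0 : ℝ) ≤ N by linarith)
  have h2 := log_le_div_ten_pow_add (show (0 : ℝ) < N by linarith) 6
  have h3 := psi_natCast_le (N / 28)
  have h4 : ((N / 28 : ℕ) : ℝ) ≤ (N : ℝ) / 28 := by exact_mod_cast Nat.cast_div_le (m := N) (n := 28)
  rw [hc] at h
  simp only [weightedSum_cons, weightedSum_nil, Nat.div_one] at h
  norm_num at h h1 h2 h3
  linarith

/-- A contraction on upper slopes. The weights bound `ψ(N) - ψ(N/15) + ψ(N/17) - ψ(N/28)`: here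
`43/420 = 1/15 + 1/28`, and `0.95406` is just above `1.00823 - 0.9212/17`. Its fixed point is about
`1.0629`. -/
theorem psi_natCast_le_of_psi_natCast_le {u b : ℝ} {K : ℕ} (hu : 0 ≤ u) (hK : 420 ≤ K)
    (hψ : ∀ N : ℕ, K ≤ N → psi (N : ℝ) ≤ u * N + b) {N : ℕ} (hN : 28 * K ≤ N) :
    psi (N : ℝ) ≤ (0.95406 + u * (43 / 420)) * N + (2 * b + 300) := by
  have h := psi_inequality_of_floorComb upperWeights' [(15, 1), (17, -1), (28, 1), (1, -1)] 420
    (by norm_num) (by decide +kernel) (by decide +kernel) (by decide +kernel) (by decide +kernel)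
    N (by omega)
  have hN' : (420 : ℝ) ≤ N := by exact_mod_cast (show 420 ≤ N by omega)
  have hc : (upperWeights'.map fun p => |(p.2 : ℝ)|).sum = 12 := by norm_num [upperWeights']
  have h1 := mul_le_mul_of_nonneg_left neg_weightedSum_upperWeights'_lt.le
    (show (0 : ℝ) ≤ N by linarith)
  have h2 := log_le_div_ten_pow_add (show (0 : ℝ) < N by linarith) 6
  have h3 := hψ (N / 28) (by omega)
  have h4 : ((N / 28 : ℕ) : ℝ) ≤ (N : ℝ) / 28 := by exact_mod_cast Nat.cast_div_le (m := N) (n := 28)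
  have h5 := hψ (N / 15) (by omega)
  have h6 : ((N / 15 : ℕ) : ℝ) ≤ (N : ℝ) / 15 := by exact_mod_cast Nat.cast_div_le (m := N) (n := 15)
  have h7 := le_psi_natCast (N := N / 17) (by omega)
  have h8 : (N : ℝ) ≤ 17 * ((N / 17 : ℕ) : ℝ) + 17 := by
    exact_mod_cast (show N ≤ 17 * (N / 17) + 17 by omega)
  have h9 := mul_le_mul_of_nonneg_left h4 hu
  have h10 := mul_le_mul_of_nonneg_left h6 hu
  rw [hc] at h
  simp only [weightedSum_cons, weightedSum_nil, Nat.div_one] at h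
  norm_num at h h1 h2 h3 h7
  linarith

/-- Two contraction steps take the slope `1.0854` to `1.0652` to `1.0632`; each multiplies the
threshold by 28, and `329280 = 28 ^ 2 * 420`. -/
theorem psi_natCast_le_of_large {N : ℕ} (hN : 329280 ≤ N) : psi (N : ℝ) ≤ 1.0632 * N + 46000 := by
  have h1 : ∀ N : ℕ, 28 * 420 ≤ N → psi (N : ℝ) ≤ 1.0652 * N + 22300 := by
    intro N hN
    have h := psi_natCast_le_of_psi_natCast_le (u := 1.0854) (b := 11000) (K := 420) (by norm_num)
      (by norm_num) (fun N hN => psi_natCast_le_of_ge hN) hN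
    have : (0 : ℝ) ≤ N := Nat.cast_nonneg N
    norm_num at h ⊢
    linarith
  have h := psi_natCast_le_of_psi_natCast_le (by norm_num) (by norm_num) h1 (N := N) (by omega)
  have : (0 : ℝ) ≤ N := Nat.cast_nonneg N
  norm_num at h ⊢
  linarith

theorem le_psi_natCast_of_large {N : ℕ} (hN : 10 ^ 7 ≤ N) : 0.9378 * N - 93000 ≤ psi (N : ℝ) := by
  -- A lower bound for `ψ(N) + ψ(N/13) + ψ(N/19)`, from which the sharp upper bounds for the last
  -- two are subtracted.
  have h := psi_inequality_of_floorComb lowerWeights' [(13, 1), (19, 1), (1, 1)] 420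
    (by norm_num) (by decide +kernel) (by decide +kernel) (by decide +kernel) (by decide +kernel)
    N (by omega)
  have hN' : (420 : ℝ) ≤ N := by exact_mod_cast (show 420 ≤ N by omega)
  have hc : (lowerWeights'.map fun p => |(p.2 : ℝ)|).sum = 17 := by norm_num [lowerWeights']
  have h1 := mul_le_mul_of_nonneg_left lt_weightedSum_lowerWeights'.le
    (show (0 : ℝ) ≤ N by linarith)
  have h2 := log_le_div_ten_pow_add (show (0 : ℝ) < N by linarith) 6
  have h3 := psi_natCast_le_of_large (N := N / 13) (by omega)
  have h4 : ((N / 13 : ℕ) : ℝ) ≤ (N : ℝ) / 13 := by exact_mod_cast Nat.cast_div_le (m := N) (n := 13)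
  have h5 := psi_natCast_le_of_large (N := N / 19) (by omega)
  have h6 : ((N / 19 : ℕ) : ℝ) ≤ (N : ℝ) / 19 := by exact_mod_cast Nat.cast_div_le (m := N) (n := 19)
  rw [hc] at h
  simp only [weightedSum_cons, weightedSum_nil, Nat.div_one] at h
  norm_num at h h1 h2 h3 h5
  norm_num
  linarith

/-! ### Primes between `a` and `1.144 a` -/

theorem psi_sub_theta_le_of_large {x : ℝ} (hx : 10 ^ 8 ≤ x) : psi x - theta x ≤ 0.0037 * x := by
  have h := psi_sub_theta_le (x := x) (by linarith)
  set s := √x with hs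
  have hs4 : 10 ^ 4 ≤ s := Real.le_sqrt_of_sq_le (by linarith)
  have hs0 : 0 < s := by linarith
  have hss : s * s = x := Real.mul_self_sqrt (by linarith)
  have hlog : Real.log x = 2 * Real.log s := by
    rw [← hss, Real.log_mul hs0.ne' hs0.ne']; ring
  have h1 := log_le_div_ten_pow_add hs0 4
  rw [hlog] at h
  norm_num at h1
  have h2 : s * Real.log s ≤ s * (s / 10000 + 8.2104) :=
    mul_le_mul_of_nonneg_left (by linarith) hs0.le
  have h3 : s * 10 ^ 4 ≤ s * s := mul_le_mul_of_nonneg_left hs4 hs0.le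
  norm_num at *
  nlinarith

theorem exists_prime_gt_of_large {a : ℕ} (ha : 10 ^ 8 ≤ a) :
    ∃ p, p.Prime ∧ a < p ∧ 1000 * p < 1144 * a := by
  by_contra! hcon
  -- The largest integer with `1000 * y < 1144 * a`; no primes in `(a, y]` means `θ(y) ≤ θ(a)`.
  set y := (1144 * a - 1) / 1000 with hy
  have hay : a ≤ y := by omega
  have hθ : theta (y : ℝ) ≤ theta (a : ℝ) := by
    rw [theta, theta, Nat.floor_natCast, Nat.floor_natCast]
    refine sum_le_sum_of_subset_of_nonneg ?_ fun i _ _ => Real.log_natCast_nonneg i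
    intro p hp
    simp only [mem_filter, mem_Ioc] at hp ⊢
    refine ⟨⟨hp.1.1, ?_⟩, hp.2⟩
    by_contra! hlt
    have := hcon p hp.2 hlt
    omega
  have ha' : (10 ^ 8 : ℝ) ≤ a := by exact_mod_cast ha
  have hay' : (a : ℝ) ≤ y := by exact_mod_cast hay
  have hy' : (1144 : ℝ) * a ≤ 1000 * y + 1001 := by
    exact_mod_cast (show 1144 * a ≤ 1000 * y + 1001 by omega)
  have h1 := psi_sub_theta_le_of_large (ha'.trans hay')
  have h2 := le_psi_natCast_of_large (N := y) (by omega)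
  have h3 := psi_natCast_le_of_large (N := a) (by omega)
  have h4 := theta_le_psi (a : ℝ)
  norm_num at h1 h2 h3
  linarith

/-- Decreasing primes down to `37`, each less than `1.144` times the next one. -/
def primeLadder : List ℕ :=
  [103186781, 90198259, 78844639, 68920141, 60244907, 52661647, 46032911, 40238567, 35173583,
    30746189, 26876077, 23493077, 20535929, 17950987, 15691439, 13716299, 11989781, 10480579,
    9161353, 8008181, 7000171, 6119033, 5348809, 4675547, 4087019, 3572579, 3122893, 2729827,
    2386217, 2085857, 1823303, 1593799, 1393193, 1217833, 1064549, 930551, 813427, 711041,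
    621541, 543313, 474941, 415159, 362903, 317227, 277301, 242399, 211891, 185221, 161911,
    141539, 123733, 108161, 94559, 82657, 72271, 63179, 55229, 48281, 42209, 36901, 32261, 28229,
    24709, 21617, 18919, 16561, 14479, 12659, 11071, 9679, 8467, 7411, 6481, 5669, 4957, 4339,
    3793, 3319, 2903, 2539, 2221, 1951, 1723, 1511, 1327, 1187, 1039, 911, 797, 701, 619, 547,
    479, 421, 373, 331, 293, 257, 227, 199, 179, 157, 139, 127, 113, 101, 89, 83, 73, 67, 59, 53,
    47, 43, 41, 37]

theorem prime_of_mem_primeLadder : ∀ p ∈ primeLadder, p.Prime := by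
  simp only [primeLadder, List.forall_mem_cons]
  norm_num

/-- Consecutive entries with `q ≤ a < p` give `1000 * p < 1144 * q ≤ 1144 * a`. -/
theorem exists_prime_of_ladder (l : List ℕ) (hp : ∀ p ∈ l, p.Prime)
    (hl : l.IsChain fun p q => 1000 * p < 1144 * q) {a : ℕ} (h1 : ∀ p ∈ l.head?, a < p)
    (h2 : ∃ q ∈ l, q ≤ a) : ∃ p, p.Prime ∧ a < p ∧ 1000 * p < 1144 * a := by
  induction l with
  | nil => simp at h2
  | cons p l ih =>
    have hap : a < p := h1 p (by simp)
    cases l with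
    | nil =>
      obtain ⟨q, hq, hqa⟩ := h2
      simp only [List.mem_singleton] at hq
      omega
    | cons q l =>
      rw [List.isChain_cons_cons] at hl
      by_cases hqa : q ≤ a
      · exact ⟨p, hp p (by simp), hap, by omega⟩
      · refine ih (fun r hr => hp r (List.mem_cons_of_mem _ hr)) hl.2 (by simpa using hqa) ?_
        obtain ⟨r, hr, hra⟩ := h2
        rcases List.mem_cons.1 hr with rfl | hr
        · omega
        · exact ⟨r, hr, hra⟩

/-- For `37 ≤ a` there is a prime strictly between `a` and `1.144 * a`. -/
theorem exists_prime_gt_and_lt {a : ℕ} (ha : 37 ≤ a) :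
    ∃ p, p.Prime ∧ a < p ∧ 1000 * p < 1144 * a := by
  rcases le_or_gt (10 ^ 8) a with h | h
  · exact exists_prime_gt_of_large h
  · refine exists_prime_of_ladder primeLadder prime_of_mem_primeLadder (by decide +kernel) ?_ ?_
    · simp only [primeLadder, List.head?_cons, Option.mem_def, Option.some.injEq, forall_eq']
      omega
    · exact ⟨37, by decide +kernel, ha⟩

/-! ### Arithmetic of the exponent `t` -/

theorem expo_cases (m : ℕ) :
    (m % 2 = 1 ∧ 2 * expo m = m + 1) ∨ (m % 4 = 0 ∧ 2 * expo m = m + 2) ∨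
      (m % 4 = 2 ∧ 2 * expo m = m + 4) := by
  unfold expo
  split_ifs <;> omega

theorem expo_lt {m : ℕ} (hm : 6 < m ∨ m = 5) : expo m < m := by
  rcases expo_cases m with h | h | h <;> omega

/-- The gcd divides `2t - m`, which is 1, 2 or 4; when `m` is even, `t` is odd. -/
theorem coprime_expo (m : ℕ) : (expo m).Coprime m := by
  have h1 := Nat.gcd_dvd_left (expo m) m
  have h2 := Nat.gcd_dvd_right (expo m) m
  rcases expo_cases m with ⟨h, h'⟩ | ⟨h, h'⟩ | ⟨h, h'⟩
  · have : (expo m).gcd m ∣ m + 1 := h' ▸ Dvd.dvd.mul_left h1 2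
    exact Nat.dvd_one.1 ((Nat.dvd_add_right h2).1 this)
  · have h3 : (expo m).gcd m ∣ m + 2 := h' ▸ Dvd.dvd.mul_left h1 2
    have h4 := (Nat.dvd_add_right h2).1 h3
    rcases (Nat.dvd_prime Nat.prime_two).1 h4 with h5 | h5
    · exact h5
    · rw [h5] at h1; omega
  · have h3 : (expo m).gcd m ∣ m + 4 := h' ▸ Dvd.dvd.mul_left h1 2
    have h4 : (expo m).gcd m ∣ 2 ^ 2 := (Nat.dvd_add_right h2).1 h3
    obtain ⟨i, hi, hi'⟩ := (Nat.dvd_prime_pow Nat.prime_two).1 h4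
    rcases Nat.eq_zero_or_pos i with rfl | h0
    · simpa using hi'
    · have h5 : 2 ∣ (expo m).gcd m := hi' ▸ dvd_pow_self 2 h0.ne'
      have := h5.trans h1
      omega

theorem two_lt_totient {m : ℕ} (hm : 6 < m ∨ m = 5) : 2 < m.totient := by
  have h := expo_cases m
  rw [Nat.totient_eq_card_coprime]
  -- Three distinct units modulo `m`; for `m = 6` the last two would coincide.
  have hsub : ({1, expo m, m - 1} : Finset ℕ) ⊆ (Finset.range m).filter m.Coprime := by
    intro x hx
    simp only [Finset.mem_insert, Finset.mem_singleton] at hx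
    simp only [Finset.mem_filter, Finset.mem_range]
    rcases hx with rfl | rfl | rfl
    · exact ⟨by omega, Nat.coprime_one_right m⟩
    · exact ⟨expo_lt hm, (coprime_expo m).symm⟩
    · exact ⟨by omega, ((Nat.coprime_self_sub_right (by omega)).2 (Nat.coprime_one_right m))⟩
  refine lt_of_lt_of_le ?_ (Finset.card_le_card hsub)
  rw [Finset.card_eq_three.2 ⟨1, expo m, m - 1, by omega, by omega, by omega, rfl⟩]
  norm_num

theorem lt_ratio₁ {d m : ℕ} (hd : 1 ≤ d) (hm : 6 < m) :
    1.144 < ((d : ℝ) * m + 1) / ((d : ℝ) * expo m + 2) := by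
  have hd' : (1 : ℝ) ≤ d := by exact_mod_cast hd
  rw [lt_div_iff₀ (by positivity)]
  -- Only `d * (m - 1.144 t) > 2 * 1.144 - 1 = 1.288` is needed.
  have key : (1.5 : ℝ) ≤ m - 1.144 * expo m := by
    rcases expo_cases m with ⟨h, h'⟩ | ⟨h, h'⟩ | ⟨h, h'⟩
    · have h1 : (7 : ℝ) ≤ m := by exact_mod_cast hm
      have h2 : (2 : ℝ) * expo m = m + 1 := by exact_mod_cast h'
      linarith
    · have h1 : (8 : ℝ) ≤ m := by exact_mod_cast (show 8 ≤ m by omega)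
      have h2 : (2 : ℝ) * expo m = m + 2 := by exact_mod_cast h'
      linarith
    · have h1 : (10 : ℝ) ≤ m := by exact_mod_cast (show 10 ≤ m by omega)
      have h2 : (2 : ℝ) * expo m = m + 4 := by exact_mod_cast h'
      linarith
  nlinarith

theorem lt_ratio₂ {d m : ℕ} (hd : 1 ≤ d) (hm : 6 < m) :
    1.144 < ((d : ℝ) * m + 1) / (((d : ℝ) * m + 1) + 1 - (d : ℝ) * expo m) := by
  have hd' : (1 : ℝ) ≤ d := by exact_mod_cast hd
  have h1 : (7 : ℝ) ≤ m := by exact_mod_cast hm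
  have h2 : (expo m : ℝ) ≤ m := by exact_mod_cast (expo_lt (Or.inl hm)).le
  have h3 : (m : ℝ) ≤ 2 * expo m := by
    exact_mod_cast (show m ≤ 2 * expo m by rcases expo_cases m with h | h | h <;> omega)
  rw [lt_div_iff₀ (by nlinarith)]
  nlinarith

/-! ### The prime attached to a weight, and the table -/

theorem gcdIndex_mul_charOrder (k p : ℕ) : gcdIndex k p * charOrder k p = p - 1 :=
  Nat.mul_div_cancel' (Nat.gcd_dvd_left _ _)

theorem IsWeightPrime.prime_and_lt {k p : ℕ} (h : IsWeightPrime k p) : p.Prime ∧ k < p := by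
  unfold IsWeightPrime at h
  split_ifs at h with hk
  · subst h; subst hk; norm_num
  · exact h.1

theorem IsWeightPrime.unique {k p q : ℕ} (hp : IsWeightPrime k p) (hq : IsWeightPrime k q) :
    p = q := by
  unfold IsWeightPrime at hp hq
  split_ifs at hp hq
  · rw [hp, hq]
  · exact hp.unique hq

theorem IsWeightPrime.le {k p r : ℕ} (hp : IsWeightPrime k p) (hk : k ≠ 32) (hr : r.Prime)
    (hkr : k < r) : p ≤ r := by
  unfold IsWeightPrime at hp
  rw [if_neg hk] at hp
  exact hp.2 ⟨hr, hkr⟩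

theorem isWeightPrime_of_forall {k p : ℕ} (hk : k ≠ 32) (hp : p.Prime) (hkp : k < p)
    (h : ∀ r < p, k < r → ¬ r.Prime) : IsWeightPrime k p := by
  unfold IsWeightPrime
  rw [if_neg hk]
  exact ⟨⟨hp, hkp⟩, fun r hr => by
    by_contra! hlt
    exact h r hlt hr.2 hr.1⟩

/-- The exception at `k = 32` is needed: `p = 37` would give `d = m = 6`, `t = 5` and `dt + 2 = 32`,
no reduction. -/
theorem weightTable : TableRow 10 11 2 5 3 8 6 ∧
    TableRow 16 17 2 8 5 12 8 ∧
    TableRow 18 19 2 9 5 12 10 ∧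
    TableRow 20 23 2 11 6 14 12 ∧
    TableRow 22 23 2 11 6 14 12 ∧
    TableRow 24 29 2 14 9 20 12 ∧
    TableRow 26 29 4 7 4 18 14 ∧
    TableRow 28 29 2 14 9 20 12 ∧
    TableRow 30 31 2 15 8 18 16 ∧
    TableRow 32 43 6 7 4 26 20 ∧
    TableRow 34 37 4 9 5 22 18 ∧
    TableRow 36 37 2 18 11 24 16 := by
  refine ⟨⟨?_, ?_⟩, ⟨?_, ?_⟩, ⟨?_, ?_⟩, ⟨?_, ?_⟩, ⟨?_, ?_⟩, ⟨?_, ?_⟩, ⟨?_, ?_⟩, ⟨?_, ?_⟩, ⟨?_, ?_⟩,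
    ⟨?_, ?_⟩, ⟨?_, ?_⟩, ⟨?_, ?_⟩⟩
  all_goals first
    | exact (if_pos rfl).mpr rfl
    | exact isWeightPrime_of_forall (by norm_num) (by norm_num) (by norm_num) (by decide +kernel)
    | decide +kernel

/-! ### Weight reduction and consecutive primes -/

theorem IsWeightPrime.ratio_lt {k p : ℕ} (hp : IsWeightPrime k p) (hk : 36 < k) (he : Even k) :
    1000 * p < 1144 * (k - 1) := by
  -- Starting from `k - 1` sharpens the bound; the even number `k` is not prime, so still `k < r`.
  obtain ⟨r, hr, h1, h2⟩ := exists_prime_gt_and_lt (a := k - 1) (by obtain ⟨c, rfl⟩ := he; omega)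
  have hrk : r ≠ k := by
    rintro rfl
    rcases hr.eq_two_or_odd' with h | h
    · omega
    · exact (Nat.not_even_iff_odd.2 h) he
  have := hp.le (by omega) hr (by omega)
  omega

theorem six_lt_charOrder {k p : ℕ} (hp : IsWeightPrime k p) (hk : 36 < k) (he : Even k) :
    6 < charOrder k p := by
  have h1 := hp.ratio_lt hk he
  have h2 := gcdIndex_mul_charOrder k p
  have h3 := hp.prime_and_lt.2
  obtain ⟨c, hc⟩ : gcdIndex k p ∣ k - 2 := Nat.gcd_dvd_right _ _
  generalize gcdIndex k p = d at *
  generalize charOrder k p = m at *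
  -- With `k - 2 = dc` and `p - 1 = dm`, `m ≤ 6` would give `m / c ≥ 6/5`.
  have hcm : c < m := by
    have : d * c < d * m := by omega
    exact lt_of_mul_lt_mul_left this (Nat.zero_le d)
  by_contra! hm
  have h4 : d * (c + 1) ≤ d * m := Nat.mul_le_mul_left d hcm
  have h5 : d * m ≤ d * 6 := Nat.mul_le_mul_left d hm
  rw [mul_add] at h4
  omega

theorem newWeight_bounds {k p : ℕ} (hp : IsWeightPrime k p) (hm : 6 < charOrder k p) :
    0 < newWeight₁ k p ∧ 0 < newWeight₂ k p ∧
    1.144 < (p : ℝ) / (newWeight₁ k p : ℝ) ∧ 1.144 < (p : ℝ) / (newWeight₂ k p : ℝ) := by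
  have h2 := gcdIndex_mul_charOrder k p
  have h3 := hp.prime_and_lt.1.two_le
  have hd : 1 ≤ gcdIndex k p := Nat.gcd_pos_of_pos_left _ (by omega)
  have hp' : (p : ℝ) = (gcdIndex k p : ℝ) * charOrder k p + 1 := by
    exact_mod_cast (show p = gcdIndex k p * charOrder k p + 1 by omega)
  have hle := Nat.mul_le_mul_left (gcdIndex k p) (expo_lt (Or.inl hm)).le
  refine ⟨by unfold newWeight₁; positivity, ?_, ?_, ?_⟩
  · unfold newWeight₂
    have : gcdIndex k p * expo (charOrder k p) < p + 1 := by omega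
    have : (gcdIndex k p : ℤ) * expo (charOrder k p) < p + 1 := by exact_mod_cast this
    omega
  · have := lt_ratio₁ hd hm
    rw [← hp'] at this
    simpa [newWeight₁] using this
  · have := lt_ratio₂ hd hm
    rw [← hp'] at this
    simpa [newWeight₂] using this

theorem lt_of_lt_div {p q : ℕ} {w : ℤ} (hw : 0 < w) (h : 1.144 < (p : ℝ) / (w : ℝ))
    (hq : 1000 * p < 1144 * q) : w < (q : ℤ) := by
  have hw' : (0 : ℝ) < w := by exact_mod_cast hw
  rw [lt_div_iff₀ hw'] at h
  have hq' : (1000 : ℝ) * p < 1144 * q := by exact_mod_cast hq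
  have : (w : ℝ) < q := by
    norm_num at h
    linarith
  exact_mod_cast this

theorem weight_gt_thirtySix {k p q : ℕ} (he : Even k) (hk : 36 < k) (hp : IsWeightPrime k p)
    (hq : IsGreatest {l : ℕ | l.Prime ∧ l < k} q) :
    ((p : ℝ) - 1) / ((k : ℝ) - 2) < 1.15 ∧
      1.144 < (p : ℝ) / (newWeight₁ k p : ℝ) ∧
      1.144 < (p : ℝ) / (newWeight₂ k p : ℝ) ∧
      newWeight₁ k p < (q : ℤ) ∧ newWeight₂ k p < (q : ℤ) := by
  obtain ⟨h1, h2, h3, h4⟩ := newWeight_bounds hp (six_lt_charOrder hp hk he)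
  have hk38 : 38 ≤ k := by obtain ⟨c, rfl⟩ := he; omega
  have hq37 : 37 ≤ q := hq.2 ⟨by norm_num, by omega⟩
  obtain ⟨r, hr, hqr, hrq⟩ := exists_prime_gt_and_lt hq37
  have hkr : k < r := by
    by_contra! hle
    rcases hle.lt_or_eq with hlt | rfl
    · have := hq.2 ⟨hr, hlt⟩
      omega
    · rcases hr.eq_two_or_odd' with h | h
      · omega
      · exact (Nat.not_even_iff_odd.2 h) he
  have hpr := hp.le (by omega) hr hkr
  refine ⟨?_, h3, h4, lt_of_lt_div h1 h3 (by omega), lt_of_lt_div h2 h4 (by omega)⟩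
  have h5 : (1000 : ℝ) * p + 1144 < 1144 * k := by
    exact_mod_cast (show 1000 * p + 1144 < 1144 * k by have := hp.ratio_lt hk he; omega)
  have h6 : (38 : ℝ) ≤ k := by exact_mod_cast hk38
  rw [div_lt_iff₀ (by linarith)]
  norm_num
  linarith

theorem weight_reduction {k p : ℕ} (he : Even k) (hk : k = 10 ∨ 14 < k)
    (hp : IsWeightPrime k p) :
    (k = 10 → charOrder k p = 5) ∧ (k ≠ 10 → 6 < charOrder k p) ∧
      newWeight₁ k p < (k : ℤ) ∧ newWeight₂ k p < (k : ℤ) := by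
  rcases lt_or_ge 36 k with h36 | h36
  · have hm := six_lt_charOrder hp h36 he
    obtain ⟨h1, h2, h3, h4⟩ := newWeight_bounds hp hm
    have := hp.ratio_lt h36 he
    exact ⟨by omega, fun _ => hm, lt_of_lt_div h1 h3 (by omega), lt_of_lt_div h2 h4 (by omega)⟩
  · have key : ∀ {P d m t : ℕ} {a b : ℤ}, TableRow k P d m t a b → (k = 10 → m = 5) →
        (k ≠ 10 → 6 < m) → a < k → b < k →
        (k = 10 → charOrder k p = 5) ∧ (k ≠ 10 → 6 < charOrder k p) ∧
          newWeight₁ k p < (k : ℤ) ∧ newWeight₂ k p < (k : ℤ) := by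
      rintro P d m t a b ⟨r1, _, r3, _, r5, r6⟩ g1 g2 g3 g4
      obtain rfl := hp.unique r1
      rw [r3, r5, r6]
      exact ⟨g1, g2, g3, g4⟩
    obtain ⟨t10, t16, t18, t20, t22, t24, t26, t28, t30, t32, t34, t36⟩ := weightTable
    obtain ⟨c, rfl⟩ := he
    have hc : c = 5 ∨ (8 ≤ c ∧ c ≤ 18) := by omega
    rcases hc with rfl | ⟨hc1, hc2⟩
    · exact key t10 (by norm_num) (by norm_num) (by norm_num) (by norm_num)
    · interval_cases c
      · exact key t16 (by norm_num) (by norm_num) (by norm_num) (by norm_num)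
      · exact key t18 (by norm_num) (by norm_num) (by norm_num) (by norm_num)
      · exact key t20 (by norm_num) (by norm_num) (by norm_num) (by norm_num)
      · exact key t22 (by norm_num) (by norm_num) (by norm_num) (by norm_num)
      · exact key t24 (by norm_num) (by norm_num) (by norm_num) (by norm_num)
      · exact key t26 (by norm_num) (by norm_num) (by norm_num) (by norm_num)
      · exact key t28 (by norm_num) (by norm_num) (by norm_num) (by norm_num)
      · exact key t30 (by norm_num) (by norm_num) (by norm_num) (by norm_num)
      · exact key t32 (by norm_num) (by norm_num) (by norm_num) (by norm_num)
      · exact key t34 (by norm_num) (by norm_num) (by norm_num) (by norm_num)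
      · exact key t36 (by norm_num) (by norm_num) (by norm_num) (by norm_num)

theorem nth_prime_ratio_lt {n : ℕ} (hn : 37 < Nat.nth Nat.Prime (n + 1)) :
    (Nat.nth Nat.Prime (n + 1) : ℝ) / (Nat.nth Nat.Prime n : ℝ) < 1.144 ∧
      ((Nat.nth Nat.Prime (n + 1) : ℝ) - 1) / ((Nat.nth Nat.Prime n : ℝ) - 1) < 1.15 := by
  have h37 : 37 ≤ Nat.nth Nat.Prime n := Nat.le_nth_of_lt_nth_succ hn (by norm_num)
  obtain ⟨r, hr, h1, h2⟩ := exists_prime_gt_and_lt h37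
  have hle : Nat.nth Nat.Prime (n + 1) ≤ r := by
    by_contra! hlt
    have := Nat.le_nth_of_lt_nth_succ hlt hr
    omega
  generalize Nat.nth Nat.Prime n = a at *
  generalize Nat.nth Nat.Prime (n + 1) = b at *
  have h37' : (37 : ℝ) ≤ a := by exact_mod_cast h37
  have hb : (1000 : ℝ) * b < 1144 * a := by exact_mod_cast (show 1000 * b < 1144 * a by omega)
  constructor
  · rw [div_lt_iff₀ (by linarith)]
    norm_num
    linarith
  -- Subtracting 1 from both primes costs `144` in `1000(b - 1) < 1144(a - 1) + 144`, less than `6(a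
  -- - 1)` as `a ≥ 37`.
  · rw [div_lt_iff₀ (by linarith)]
    norm_num
    linarith

end WeightReduction

theorem mainTheorem2 :
    -- the weight reduction
    (∀ k p : ℕ, Even k → (k = 10 ∨ 14 < k) → WeightReduction.IsWeightPrime k p →
      WeightReduction.gcdIndex k p * WeightReduction.charOrder k p = p - 1 ∧
      (k = 10 → WeightReduction.charOrder k p = 5) ∧
      (k ≠ 10 → 6 < WeightReduction.charOrder k p) ∧
      2 < Nat.totient (WeightReduction.charOrder k p) ∧
      WeightReduction.expo (WeightReduction.charOrder k p) < WeightReduction.charOrder k p ∧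
      Nat.Coprime (WeightReduction.expo (WeightReduction.charOrder k p))
        (WeightReduction.charOrder k p) ∧
      WeightReduction.newWeight₁ k p < (k : ℤ) ∧
      WeightReduction.newWeight₂ k p < (k : ℤ)) ∧
    -- the table for `k ≤ 36`
    (WeightReduction.TableRow 10 11 2 5 3 8 6 ∧
      WeightReduction.TableRow 16 17 2 8 5 12 8 ∧
      WeightReduction.TableRow 18 19 2 9 5 12 10 ∧
      WeightReduction.TableRow 20 23 2 11 6 14 12 ∧
      WeightReduction.TableRow 22 23 2 11 6 14 12 ∧
      WeightReduction.TableRow 24 29 2 14 9 20 12 ∧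
      WeightReduction.TableRow 26 29 4 7 4 18 14 ∧
      WeightReduction.TableRow 28 29 2 14 9 20 12 ∧
      WeightReduction.TableRow 30 31 2 15 8 18 16 ∧
      WeightReduction.TableRow 32 43 6 7 4 26 20 ∧
      WeightReduction.TableRow 34 37 4 9 5 22 18 ∧
      WeightReduction.TableRow 36 37 2 18 11 24 16) ∧
    -- for `k > 36`, with `q < k < p` the neighbouring primes of `k`
    (∀ k p q : ℕ, Even k → 36 < k → WeightReduction.IsWeightPrime k p →
      IsGreatest {l : ℕ | l.Prime ∧ l < k} q →
      ((p : ℝ) - 1) / ((k : ℝ) - 2) < 1.15 ∧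
      1.144 < (p : ℝ) / (WeightReduction.newWeight₁ k p : ℝ) ∧
      1.144 < (p : ℝ) / (WeightReduction.newWeight₂ k p : ℝ) ∧
      WeightReduction.newWeight₁ k p < (q : ℤ) ∧
      WeightReduction.newWeight₂ k p < (q : ℤ)) ∧
    -- consecutive primes
    (∀ n : ℕ, 37 < Nat.nth Nat.Prime (n + 1) →
      (Nat.nth Nat.Prime (n + 1) : ℝ) / (Nat.nth Nat.Prime n : ℝ) < 1.144 ∧
      ((Nat.nth Nat.Prime (n + 1) : ℝ) - 1) / ((Nat.nth Nat.Prime n : ℝ) - 1) < 1.15) ∧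
    -- computation (*), where `d m + 1` plays the role of `p`
    (∀ d m : ℕ, 1 ≤ d → 6 < m →
      1.144 < ((d : ℝ) * m + 1) / ((d : ℝ) * WeightReduction.expo m + 2) ∧
      1.144 < ((d : ℝ) * m + 1) / (((d : ℝ) * m + 1) + 1 - (d : ℝ) * WeightReduction.expo m)) := by
  refine ⟨fun k p he hk hp => ?_, WeightReduction.weightTable,
    fun k p q he hk hp hq => WeightReduction.weight_gt_thirtySix he hk hp hq,
    fun n hn => WeightReduction.nth_prime_ratio_lt hn,
    fun d m hd hm => ⟨WeightReduction.lt_ratio₁ hd hm, WeightReduction.lt_ratio₂ hd hm⟩⟩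
  obtain ⟨h1, h2, h3, h4⟩ := WeightReduction.weight_reduction he hk hp
  have hm : 6 < WeightReduction.charOrder k p ∨ WeightReduction.charOrder k p = 5 := by
    by_cases h : k = 10
    · exact Or.inr (h1 h)
    · exact Or.inl (h2 h)
  exact ⟨WeightReduction.gcdIndex_mul_charOrder k p, h1, h2, WeightReduction.two_lt_totient hm,
    WeightReduction.expo_lt hm, WeightReduction.coprime_expo _, h3, h4⟩
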